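/- Let $\mathbb{K}$ be an algebraically closed field of characteristic $0$ and let $\ell$ be a positive integer. For $i=1,\dots,\ell$ let $r_i,d_i$ be positive integers, and let $n\ge \prod_{i=1}^{\ell}\binom{r_i+d_i}{d_i}-1$. For $i=1,\dots,\ell$ let $f_{i0},\dots,f_{in}\in\mathbb{K}[y_0,\dots,y_{r_i}]$ be forms of degree $d_i$, and let $X_i\subset\mathbb{P}^n$ be the parameterized subvariety which is the Zariski closure of $\{[f_{i0}(y):\cdots:f_{in}(y)] : y\in\mathbb{K}^{r_i+1},\ (f_{i0}(y),\dots,f_{in}(y))\neq 0\}$. Let the Hadamard product $X_1\odot\cdots\odot X_\ell\subset\mathbb{P}^n$ be the Zariski closure of the set of all coordinatewise products of points $P_1\in X_1,\dots,P_\ell\in X_\ell$ that are defined (i.e. not all of whose coordinates are zero). By the product variety $X_1\times\cdots\times X_\ell$ as a subvariety of $\mathbb{P}^n$ we mean the following: choose linear subspaces $L_i\cong\mathbb{P}^{h_i}$ of $\mathbb{P}^n$ with $X_i\subseteq L_i$ and $n\ge\prod_i(h_i+1)-1$, regard $X_i$ as a subvariety of $\mathbb{P}^{h_i}$, and take the image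 of $X_1\times\cdots\times X_\ell$ under the Segre embedding of $\mathbb{P}^{h_1}\times\cdots\times\mathbb{P}^{h_\ell}$ into $\mathbb{P}^{\prod_i(h_i+1)-1}$, the latter being embedded in $\mathbb{P}^n$ as a linear subspace. Then for generic forms $f_{ij}$ (that is, for all families of forms $(f_{ij})$ whose coefficients lie in some fixed nonempty Zariski open subset of the affine space of all coefficients), the product variety $X_1\times\cdots\times X_\ell$ exists as a subvariety of $\mathbb{P}^n$ (such $L_i$ can be chosen), and, for every choice made in its construction, some projective linear automorphism of $\mathbb{P}^n$ maps $X_1\odot\cdots\odot X_\ell$ onto it; that is, $X_1\odot\cdots\odot X_\ell$ and $X_1\times\cdots\times X_\ell$ are projectively equivalent as subvarieties of $\mathbb{P}^n$. -/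

import Mathlib

open scoped LinearAlgebra.Projectivization

namespace HadamardVar

/-- Projective `n`-space over `K`, as a set of `K`-points with homogeneous coordinates. -/
abbrev Pn (K : Type*) [Field K] (n : ℕ) : Type _ := ℙ K (Fin (n + 1) → K)

section

variable {K : Type*} [Field K] {n : ℕ}

/-- Zariski closure of a set of points of `ℙⁿ`: the common zeros of all forms that vanish on the
set. (For a form, vanishing does not depend on the choice of homogeneous coordinates.) -/
def zariskiClosure (Z : Set (Pn K n)) : Set (Pn K n) :=
  {P | ∀ (e : ℕ) (F : MvPolynomial (Fin (n + 1)) K), F.IsHomogeneous e →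
    (∀ Q ∈ Z, MvPolynomial.eval Q.rep F = 0) → MvPolynomial.eval P.rep F = 0}

/-- The subvariety of `ℙⁿ` parameterized by `n + 1` forms in `r + 1` variables: the closure of the
set of all points `[f₀(y) : ⋯ : fₙ(y)]` with `f(y) ≠ 0`. -/
def paramVariety {r : ℕ} (f : Fin (n + 1) → MvPolynomial (Fin (r + 1)) K) : Set (Pn K n) :=
  zariskiClosure {R | ∃ (y : Fin (r + 1) → K) (h : (fun j => MvPolynomial.eval y (f j)) ≠ 0),
    R = Projectivization.mk K (fun j => MvPolynomial.eval y (f j)) h}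

/-- The Hadamard product `X₁ ⊙ ⋯ ⊙ X_ℓ` of subsets of `ℙⁿ`: the closure of the set of all
coordinatewise products `P₁ ⊙ ⋯ ⊙ P_ℓ` with `Pᵢ ∈ Xᵢ` that are defined, that is, not all of whose
coordinates vanish. -/
def hadamardProduct {ℓ : ℕ} (X : Fin ℓ → Set (Pn K n)) : Set (Pn K n) :=
  zariskiClosure {R | ∃ P : Fin ℓ → Pn K n, (∀ i, P i ∈ X i) ∧
    ∃ h : (fun j => ∏ i, (P i).rep j) ≠ 0,
      R = Projectivization.mk K (fun j => ∏ i, (P i).rep j) h}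

theorem segre_ne_zero {ℓ : ℕ} {h : Fin ℓ → ℕ} (Q : ∀ i, Pn K (h i)) :
    (fun J : (∀ i, Fin (h i + 1)) => ∏ i, (Q i).rep (J i)) ≠ 0 := by
  choose J hJ using fun i => Function.ne_iff.mp (Q i).rep_nonzero
  intro h0
  exact Finset.prod_ne_zero_iff.mpr (fun i _ => hJ i) (congrFun h0 J)

/-- The Segre embedding of `ℙ^{h₁} × ⋯ × ℙ^{h_ℓ}`; the coordinates of the target are indexed by
the tuples `J` with `0 ≤ Jᵢ ≤ hᵢ`. -/
noncomputable def segre {ℓ : ℕ} {h : Fin ℓ → ℕ} (Q : ∀ i, Pn K (h i)) :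
    ℙ K ((∀ i, Fin (h i + 1)) → K) :=
  Projectivization.mk K (fun J => ∏ i, (Q i).rep (J i)) (segre_ne_zero Q)

/-- `Z` is the product variety `X₁ × ⋯ × X_ℓ`, as a subvariety of `ℙⁿ`: choose linear subspaces
`Lᵢ ⊇ Xᵢ` of `ℙⁿ` with coordinates `φᵢ : ℙ^{hᵢ} ≃ Lᵢ`, and view `Xᵢ` as a subvariety of `ℙ^{hᵢ}`;
then `Z` is the image of `X₁ × ⋯ × X_ℓ` under the Segre embedding of `ℙ^{h₁} × ⋯ × ℙ^{h_ℓ}`,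
whose target is placed in `ℙⁿ` as a linear subspace by `ι`. -/
def IsProductVariety {ℓ : ℕ} (X : Fin ℓ → Set (Pn K n)) (Z : Set (Pn K n)) : Prop :=
  ∃ (h : Fin ℓ → ℕ)
    (φ : ∀ i, (Fin (h i + 1) → K) →ₗ[K] (Fin (n + 1) → K))
    (hφ : ∀ i, Function.Injective (φ i))
    (ι : ((∀ i, Fin (h i + 1)) → K) →ₗ[K] (Fin (n + 1) → K))
    (hι : Function.Injective ι),
    (∀ i, X i ⊆ Set.range (Projectivization.map (φ i) (hφ i))) ∧
    Z = (fun Q : (∀ i, Pn K (h i)) => Projectivization.map ι hι (segre Q)) ''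
      {Q | ∀ i, Projectivization.map (φ i) (hφ i) (Q i) ∈ X i}

/-- `X` and `Y` are projectively equivalent as subvarieties of `ℙⁿ`: some projective linear
automorphism of `ℙⁿ` maps `X` onto `Y`. -/
def ProjectivelyEquivalent (X Y : Set (Pn K n)) : Prop :=
  ∃ g : (Fin (n + 1) → K) ≃ₗ[K] (Fin (n + 1) → K),
    Projectivization.map g.toLinearMap g.injective '' X = Y

end

/-- The exponents of the monomials of degree `d` in `r + 1` variables. -/
abbrev Exponent (r d : ℕ) : Type := {m : Fin (r + 1) →₀ ℕ // m.degree = d}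

/-- `Φ f` holds for generic `f = (f i j)`, where `f i 0, …, f i n` are forms of degree `d i` in
`r i + 1` variables (`1 ≤ i ≤ ℓ`): it holds whenever the coefficients of the `f i j` lie in a certain
nonempty (principal) Zariski open subset of the affine space of all coefficients. -/
def ForGenericForms (K : Type*) [Field K] {ℓ : ℕ} (n : ℕ) (r d : Fin ℓ → ℕ)
    (Φ : (∀ i, Fin (n + 1) → MvPolynomial (Fin (r i + 1)) K) → Prop) : Prop :=
  ∃ D : MvPolynomial ((i : Fin ℓ) × Fin (n + 1) × Exponent (r i) (d i)) K, D ≠ 0 ∧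
    ∀ f : (∀ i, Fin (n + 1) → MvPolynomial (Fin (r i + 1)) K),
      (∀ i j, (f i j).IsHomogeneous (d i)) →
      MvPolynomial.eval (fun s => MvPolynomial.coeff s.2.2.1 (f s.1 s.2.1)) D ≠ 0 →
      Φ f

end HadamardVar

/-! Write `f i` as `A i` (its coefficient matrix) applied to the Veronese vector of `y i`. By
distributivity, the coordinatewise product of these vectors is one matrix `B`, whose j-th row is the
tensor product of the j-th rows of the `A i`, applied to the Segre-Veronese vector
(`faceSplitting_mulVec`). So the Hadamard product is governed by a linear image of the
Segre-Veronese variety.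

The bound on `n` gives `B` at least as many rows as columns, and a maximal minor is a nonzero
polynomial in the coefficients, so `B` is generically injective
(`exists_polynomial_hadamardMatrix_injective`). Then the image is already closed, because the
Segre-Veronese variety is cut out by explicit binomials (`exists_eq_smul_segreVeronese`). Each `A i`
is injective too, and every product variety is the image of the same Segre-Veronese variety under
some injective matrix `M` (`IsProductVariety.exists_eq_linearSegreVeronese`). Finally, `B w ↦ M w`
extends to an automorphism of the ambient space. -/

open scoped LinearAlgebra.Projectivization

namespace HadamardVar

open MvPolynomial

/-! ### Pure tensors, Kronecker and face-splitting products -/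

section Tensor

variable {K : Type*} [CommRing K] {ℓ : ℕ}

/-- The pure tensor `v₁ ⊗ ⋯ ⊗ v_ℓ`, in coordinates. -/
def pureTensor {κ : Fin ℓ → Type*} (v : ∀ i, κ i → K) : (∀ i, κ i) → K :=
  fun J => ∏ i, v i (J i)

/-- The Kronecker product of a family of matrices. -/
def kroneckerFamily {κ κ' : Fin ℓ → Type*} (C : ∀ i, Matrix (κ i) (κ' i) K) :
    Matrix (∀ i, κ i) (∀ i, κ' i) K :=
  fun J J' => ∏ i, C i (J i) (J' i)

/-- The face-splitting product of matrices with the same rows: each row is the tensor product of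
the corresponding rows. -/
def faceSplitting {μ : Type*} {κ : Fin ℓ → Type*} (A : ∀ i, Matrix μ (κ i) K) :
    Matrix μ (∀ i, κ i) K :=
  fun j J => ∏ i, A i j (J i)

theorem kroneckerFamily_mulVec {κ κ' : Fin ℓ → Type*} [∀ i, Fintype (κ' i)]
    (C : ∀ i, Matrix (κ i) (κ' i) K) (v : ∀ i, κ' i → K) :
    (kroneckerFamily C).mulVec (pureTensor v) = pureTensor fun i => (C i).mulVec (v i) := by
  funext J
  simp only [Matrix.mulVec, dotProduct, kroneckerFamily, pureTensor, ← Finset.prod_mul_distrib]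
  rw [Finset.prod_univ_sum, Fintype.piFinset_univ]

theorem faceSplitting_mulVec {μ : Type*} {κ : Fin ℓ → Type*} [∀ i, Fintype (κ i)]
    (A : ∀ i, Matrix μ (κ i) K) (v : ∀ i, κ i → K) :
    (faceSplitting A).mulVec (pureTensor v) = fun j => ∏ i, (A i).mulVec (v i) j := by
  funext J
  simp only [Matrix.mulVec, dotProduct, faceSplitting, pureTensor, ← Finset.prod_mul_distrib]
  rw [Finset.prod_univ_sum, Fintype.piFinset_univ]

theorem kroneckerFamily_mul {κ κ' κ'' : Fin ℓ → Type*} [∀ i, Fintype (κ' i)]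
    (C : ∀ i, Matrix (κ i) (κ' i) K) (C' : ∀ i, Matrix (κ' i) (κ'' i) K) :
    kroneckerFamily C * kroneckerFamily C' = kroneckerFamily fun i => C i * C' i := by
  ext J J'
  simp only [Matrix.mul_apply, kroneckerFamily, ← Finset.prod_mul_distrib]
  rw [Finset.prod_univ_sum, Fintype.piFinset_univ]

theorem kroneckerFamily_one {κ : Fin ℓ → Type*} [∀ i, DecidableEq (κ i)] :
    kroneckerFamily (fun i => (1 : Matrix (κ i) (κ i) K)) = 1 := by
  ext J J'
  simp only [kroneckerFamily, Matrix.one_apply, funext_iff, Finset.prod_ite_zero]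
  simp

theorem pureTensor_smul {κ : Fin ℓ → Type*} (c : Fin ℓ → K) (v : ∀ i, κ i → K) :
    pureTensor (fun i => c i • v i) = (∏ i, c i) • pureTensor v := by
  funext J
  simp [pureTensor, Finset.prod_mul_distrib]

theorem pureTensor_ne_zero [IsDomain K] {κ : Fin ℓ → Type*} {v : ∀ i, κ i → K}
    (hv : ∀ i, v i ≠ 0) : pureTensor v ≠ 0 := by
  choose J hJ using fun i => Function.ne_iff.mp (hv i)
  intro h0
  exact Finset.prod_ne_zero_iff.mpr (fun i _ => hJ i) (congrFun h0 J)

/-- A nonzero kernel vector of `A i`, tensored with all-ones vectors in the other factors, would be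
a nonzero kernel vector of the face-splitting product. -/
theorem mulVec_injective_of_faceSplitting [IsDomain K] {μ : Type*} {κ : Fin ℓ → Type*}
    [∀ i, Fintype (κ i)] [∀ i, Nonempty (κ i)] {A : ∀ i, Matrix μ (κ i) K}
    (hA : Function.Injective (faceSplitting A).mulVec) (i : Fin ℓ) :
    Function.Injective (A i).mulVec := by
  have key : ∀ v, (A i).mulVec v = 0 → v = 0 := by
    intro v hv
    by_contra hne
    have hu : ∀ k, Function.update (fun k => (1 : κ k → K)) i v k ≠ 0 := by
      intro k
      rcases eq_or_ne k i with rfl | hk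
      · simpa using hne
      · simp [Function.update_of_ne hk]
    refine pureTensor_ne_zero hu (hA ?_)
    rw [faceSplitting_mulVec, Matrix.mulVec_zero]
    funext j
    refine Finset.prod_eq_zero (Finset.mem_univ i) ?_
    simp [hv]
  intro v w hvw
  have := key (v - w) (by rw [Matrix.mulVec_sub]; exact sub_eq_zero.mpr hvw)
  exact sub_eq_zero.mp this

end Tensor

theorem exists_matrix_mul_eq_one {K : Type*} [Field K] {μ ν : Type*} [Fintype μ] [Fintype ν]
    [DecidableEq μ] [DecidableEq ν] {B : Matrix μ ν K} (hB : Function.Injective B.mulVec) :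
    ∃ L : Matrix ν μ K, L * B = 1 := by
  obtain ⟨g, hg⟩ := (Matrix.toLin' B).exists_leftInverse_of_injective
    (LinearMap.ker_eq_bot.mpr hB)
  refine ⟨LinearMap.toMatrix' g, ?_⟩
  have := congrArg LinearMap.toMatrix' hg
  rwa [LinearMap.toMatrix'_comp, LinearMap.toMatrix'_toLin', LinearMap.toMatrix'_id] at this

/-! ### Monomials of fixed degree and Veronese vectors -/

section Exponents

variable {r d : ℕ}

noncomputable instance Exponent.fintype : Fintype (Exponent r d) :=
  (Finsupp.finite_of_degree_eq d).fintype

noncomputable instance Exponent.decidableEq : DecidableEq (Exponent r d) := Classical.decEq _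

theorem card_exponent (r d : ℕ) : Fintype.card (Exponent r d) = (r + d).choose d := by
  have h := Fintype.card_congr (Sym.equivNatSum (Fin (r + 1)) d |>.trans
    (Equiv.subtypeEquivRight (q := fun m : Fin (r + 1) →₀ ℕ => m.degree = d)
      (fun _ => Iff.rfl)))
  rw [Sym.card_sym_eq_choose, Fintype.card_fin] at h
  rw [← h]
  congr 1
  omega

/-- The exponent of the power `x_a ^ d`. -/
noncomputable def Exponent.pow (d : ℕ) (a : Fin (r + 1)) : Exponent r d :=
  ⟨Finsupp.single a d, by simp⟩

/-- The exponent of `x_a ^ (d - 1) * x_b`. -/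
noncomputable def Exponent.near (hd : 0 < d) (a b : Fin (r + 1)) : Exponent r d :=
  ⟨Finsupp.single a (d - 1) + Finsupp.single b 1, by
    rw [map_add, Finsupp.degree_single, Finsupp.degree_single]; omega⟩

instance Exponent.nonempty : Nonempty (Exponent r d) := ⟨Exponent.pow d 0⟩

theorem Exponent.sum_eq (m : Exponent r d) : ∑ b, m.1 b = d := by
  rw [← Finsupp.degree_eq_sum, m.2]

variable {K : Type*} [Field K]

/-- The vector of all monomials of degree `d` at `y`. -/
def veronese (d : ℕ) (y : Fin (r + 1) → K) : Exponent r d → K := fun m => ∏ b, y b ^ m.1 b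

theorem veronese_pow (y : Fin (r + 1) → K) (a : Fin (r + 1)) :
    veronese d y (Exponent.pow d a) = y a ^ d := by
  simp only [veronese, Exponent.pow]
  rw [Finset.prod_eq_single a] <;> simp +contextual [eq_comm]

theorem veronese_near (hd : 0 < d) (y : Fin (r + 1) → K) (a b : Fin (r + 1)) :
    veronese d y (Exponent.near hd a b) = y a ^ (d - 1) * y b := by
  simp only [veronese, Exponent.near, Finsupp.add_apply, pow_add, Finset.prod_mul_distrib]
  rw [Finset.prod_eq_single a, Finset.prod_eq_single b] <;>
    simp +contextual [eq_comm]

/-- The coefficient matrix of a family of forms of degree `d`. -/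
def coeffMatrix {n : ℕ} (d : ℕ) (f : Fin (n + 1) → MvPolynomial (Fin (r + 1)) K) :
    Matrix (Fin (n + 1)) (Exponent r d) K :=
  fun j m => coeff m.1 (f j)

theorem eval_eq_sum_exponent {p : MvPolynomial (Fin (r + 1)) K} (hp : p.IsHomogeneous d)
    (y : Fin (r + 1) → K) : eval y p = ∑ m : Exponent r d, coeff m.1 p * veronese d y m := by
  rw [eval_eq']
  refine Finset.sum_bij_ne_zero (fun m hm h => ⟨m, ?_⟩) ?_ ?_ ?_ ?_
  · rw [Finsupp.degree_eq_weight_one]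
    exact hp (mem_support_iff.mp hm)
  · simp
  · intro a _ _ b _ _ h
    exact congrArg Subtype.val h
  · intro m _ hm
    exact ⟨m.1, mem_support_iff.mpr (left_ne_zero_of_mul hm), hm, rfl⟩
  · intros; rfl

theorem coeffMatrix_mulVec {n : ℕ} {f : Fin (n + 1) → MvPolynomial (Fin (r + 1)) K}
    (hf : ∀ j, (f j).IsHomogeneous d) (y : Fin (r + 1) → K) :
    (coeffMatrix d f).mulVec (veronese d y) = fun j => eval y (f j) := by
  funext j
  rw [eval_eq_sum_exponent (hf j)]
  rfl

/-- Veronese vectors span: each row of `E` is the coefficient vector of a form vanishing at every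
point of an infinite field. -/
theorem matrix_eq_zero_of_mulVec_veronese [Infinite K] {μ : Type*} {E : Matrix μ (Exponent r d) K}
    (hE : ∀ y : Fin (r + 1) → K, E.mulVec (veronese d y) = 0) : E = 0 := by
  ext j m
  let p : MvPolynomial (Fin (r + 1)) K := ∑ m : Exponent r d, monomial m.1 (E j m)
  have hp : p = 0 := by
    refine MvPolynomial.funext fun y => ?_
    have := congrFun (hE y) j
    simp only [p, map_sum, eval_monomial, map_zero]
    refine Eq.trans ?_ this
    refine Finset.sum_congr rfl fun m _ => ?_
    rw [Finsupp.prod_fintype _ _ (by simp)]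
    rfl
  have h := congrArg (coeff m.1) hp
  simpa [p, coeff_sum, coeff_monomial, Subtype.val_inj] using h

end Exponents

/-! ### Binomial equations of the Segre-Veronese variety -/

section SegreVeronese

variable {K : Type*} [Field K] {ℓ : ℕ} {r d : Fin ℓ → ℕ}

/-- The coordinates of the product of Veronese maps followed by the Segre embedding. -/
def segreVeronese (d : Fin ℓ → ℕ) (y : ∀ i, Fin (r i + 1) → K) :
    (∀ i, Exponent (r i) (d i)) → K :=
  pureTensor fun i => veronese (d i) (y i)

/-- Computes the exponent of a single variable in the product over all tuples in
`segreVeronese_pow_prod`. -/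
theorem sum_prod_mul_apply {R : Type*} [CommSemiring R] {α : Fin ℓ → Type*} [∀ i, Fintype (α i)]
    (m : ∀ i, α i → R) (i : Fin ℓ) (g : α i → R) :
    ∑ a : ∀ i, α i, (∏ k, m k (a k)) * g (a i) =
      (∏ k ∈ Finset.univ.erase i, ∑ b, m k b) * ∑ b, m i b * g b := by
  have h (a : ∀ i, α i) : (∏ k, m k (a k)) * g (a i) =
      ∏ k, Function.update m i (fun b => m i b * g b) k (a k) := by
    rw [← Finset.prod_erase_mul _ _ (Finset.mem_univ i),
      ← Finset.prod_erase_mul _ (fun k => Function.update m i _ k (a k)) (Finset.mem_univ i),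
      Function.update_self, mul_assoc]
    congr 1
    refine Finset.prod_congr rfl fun k hk => ?_
    rw [Function.update_of_ne (Finset.ne_of_mem_erase hk)]
  simp_rw [h]
  rw [← Fintype.piFinset_univ, ← Finset.prod_univ_sum,
    ← Finset.prod_erase_mul _ _ (Finset.mem_univ i), Function.update_self]
  congr 1
  refine Finset.prod_congr rfl fun k hk => ?_
  rw [Function.update_of_ne (Finset.ne_of_mem_erase hk)]

/-- A power of each coordinate of a Segre-Veronese vector is a monomial in the coordinates that
belong to tuples of pure powers. -/
theorem segreVeronese_pow_prod (y : ∀ i, Fin (r i + 1) → K) (J : ∀ i, Exponent (r i) (d i)) :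
    segreVeronese d y J ^ ∏ i, d i =
      ∏ a : ∀ i, Fin (r i + 1),
        segreVeronese d y (fun i => Exponent.pow (d i) (a i)) ^ ∏ i, (J i).1 (a i) := by
  simp only [segreVeronese, pureTensor, veronese_pow, ← Finset.prod_pow]
  rw [Finset.prod_comm]
  refine Finset.prod_congr rfl fun i _ => ?_
  -- Indicator exponents spread the power over all variables `b`, so that the products over `a` and
  -- `b` can be exchanged.
  have h (a : ∀ i, Fin (r i + 1)) : (y i (a i) ^ d i) ^ ∏ i, (J i).1 (a i) =
      ∏ b, y i b ^ ((∏ i, (J i).1 (a i)) * if a i = b then d i else 0) := by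
    rw [Finset.prod_eq_single (a i)]
    · rw [if_pos rfl, ← pow_mul, mul_comm]
    · intro b _ hb
      rw [if_neg hb.symm, mul_zero, pow_zero]
    · simp
  simp_rw [h]
  rw [Finset.prod_comm, veronese, ← Finset.prod_pow]
  refine Finset.prod_congr rfl fun b _ => ?_
  rw [Finset.prod_pow_eq_pow_sum, ← pow_mul,
    sum_prod_mul_apply (fun k c => (J k).1 c) i (fun c => if c = b then d i else 0)]
  simp only [mul_ite, mul_zero, Finset.sum_ite_eq', Finset.mem_univ, if_true, Exponent.sum_eq]
  rw [← Finset.prod_erase_mul _ _ (Finset.mem_univ i)]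
  congr 1
  ring

/-- Each coordinate of a Segre-Veronese vector, up to a power of the coordinate of a tuple of
pure powers, is a monomial in the coordinates next to that tuple. -/
theorem segreVeronese_mul_pow_sum (hd : ∀ i, 0 < d i) (y : ∀ i, Fin (r i + 1) → K)
    (a : ∀ i, Fin (r i + 1)) (J : ∀ i, Exponent (r i) (d i)) :
    segreVeronese d y J * segreVeronese d y (fun i => Exponent.pow (d i) (a i)) ^ (∑ i, d i) =
      segreVeronese d y (fun i => Exponent.pow (d i) (a i)) *
        ∏ i, ∏ b, segreVeronese d y (Function.update (fun i => Exponent.pow (d i) (a i)) i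
          (Exponent.near (hd i) (a i) b)) ^ (J i).1 b := by
  set c := segreVeronese d y (fun i => Exponent.pow (d i) (a i)) with hc
  have hc' : c = ∏ i, y i (a i) ^ d i := by
    simp only [hc, segreVeronese, pureTensor, veronese_pow]
  -- `P i` is `c` with one factor `y i (a i)` removed, so the neighbouring coordinates are `P i * y
  -- i b`.
  let P (i : Fin ℓ) : K := (∏ k ∈ Finset.univ.erase i, y k (a k) ^ d k) * y i (a i) ^ (d i - 1)
  have hP (i : Fin ℓ) : P i * y i (a i) = c := by
    rw [hc', ← Finset.prod_erase_mul _ _ (Finset.mem_univ i), mul_assoc, ← pow_succ,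
      Nat.sub_add_cancel (hd i)]
  have hnear (i : Fin ℓ) (b : Fin (r i + 1)) :
      segreVeronese d y (Function.update (fun i => Exponent.pow (d i) (a i)) i
        (Exponent.near (hd i) (a i) b)) = P i * y i b := by
    simp only [segreVeronese, pureTensor]
    rw [← Finset.prod_erase_mul _ _ (Finset.mem_univ i), Function.update_self, veronese_near,
      ← mul_assoc]
    congr 2
    refine Finset.prod_congr rfl fun k hk => ?_
    rw [Function.update_of_ne (Finset.ne_of_mem_erase hk), veronese_pow]
  have hcpow : c * ∏ i, P i ^ d i = c ^ ∑ i, d i := by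
    nth_rw 1 [hc']
    rw [← Finset.prod_mul_distrib, ← Finset.prod_pow_eq_pow_sum]
    refine Finset.prod_congr rfl fun i _ => ?_
    rw [← mul_pow, mul_comm, hP]
  have hprod (i : Fin ℓ) : ∏ b, (P i * y i b) ^ (J i).1 b =
      P i ^ d i * veronese (d i) (y i) (J i) := by
    simp only [mul_pow, Finset.prod_mul_distrib, veronese]
    rw [Finset.prod_pow_eq_pow_sum, Exponent.sum_eq]
  simp only [hnear, hprod]
  rw [Finset.prod_mul_distrib, ← mul_assoc, hcpow, mul_comm]
  rfl

/-- The image of the product of Veronese maps followed by the Segre embedding is closed: it is cut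
out by forms. -/
theorem exists_eq_smul_segreVeronese (hd : ∀ i, 0 < d i)
    {w : (∀ i, Exponent (r i) (d i)) → K} (hw : w ≠ 0)
    (hF : ∀ (e : ℕ) (F : MvPolynomial (∀ i, Exponent (r i) (d i)) K), F.IsHomogeneous e →
      (∀ y, eval (segreVeronese d y) F = 0) → eval w F = 0) :
    ∃ (c : K) (y : ∀ i, Fin (r i + 1) → K), w = c • segreVeronese d y := by
  obtain ⟨J₀, hJ₀⟩ := Function.ne_iff.mp hw
  have hpow : w J₀ ^ ∏ i, d i =
      ∏ a : ∀ i, Fin (r i + 1), w (fun i => Exponent.pow (d i) (a i)) ^ ∏ i, (J₀ i).1 (a i) := by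
    have := hF (∏ i, d i) (X J₀ ^ (∏ i, d i) - ∏ a : ∀ i, Fin (r i + 1),
      X (fun i => Exponent.pow (d i) (a i)) ^ ∏ i, (J₀ i).1 (a i)) ?_ ?_
    · simpa [sub_eq_zero] using this
    · refine IsHomogeneous.sub (isHomogeneous_X_pow _ _) ?_
      have hdeg : ∏ i, d i = ∑ a : ∀ i, Fin (r i + 1), ∏ i, (J₀ i).1 (a i) := by
        rw [← Fintype.piFinset_univ, ← Finset.prod_univ_sum]
        exact Finset.prod_congr rfl fun i _ => (Exponent.sum_eq _).symm
      rw [hdeg]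
      exact IsHomogeneous.prod _ _ _ fun a _ => isHomogeneous_X_pow _ _
    · intro y
      simpa [sub_eq_zero] using segreVeronese_pow_prod y J₀
  -- Otherwise, choosing each `a i` in the support of `J₀ i` gives a zero factor with positive
  -- exponent in `hpow`, although `w J₀ ≠ 0`.
  obtain ⟨a, ha⟩ : ∃ a : ∀ i, Fin (r i + 1), w (fun i => Exponent.pow (d i) (a i)) ≠ 0 := by
    by_contra! h0
    have hpos : ∀ i, ∃ b, (J₀ i).1 b ≠ 0 := by
      intro i
      by_contra! h
      have := Exponent.sum_eq (J₀ i)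
      simp only [h, Finset.sum_const_zero] at this
      exact (hd i).ne this
    choose a ha using hpos
    refine pow_ne_zero _ hJ₀ (hpow.trans ?_)
    refine Finset.prod_eq_zero (Finset.mem_univ a) ?_
    rw [h0, zero_pow (Finset.prod_ne_zero_iff.mpr fun i _ => ha i)]
  set c := w (fun i => Exponent.pow (d i) (a i)) with hc
  -- On the variety this ratio equals `y i b / y i (a i)`: the point is recovered in an affine
  -- chart, without extracting roots.
  refine ⟨c, fun i b => w (Function.update (fun i => Exponent.pow (d i) (a i)) i
    (Exponent.near (hd i) (a i) b)) / c, ?_⟩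
  funext J
  have hJ : w J * c ^ (∑ i, d i) = c * ∏ i, ∏ b,
      w (Function.update (fun i => Exponent.pow (d i) (a i)) i
        (Exponent.near (hd i) (a i) b)) ^ (J i).1 b := by
    have := hF (1 + ∑ i, d i) (X J * X (fun i => Exponent.pow (d i) (a i)) ^ (∑ i, d i) -
      X (fun i => Exponent.pow (d i) (a i)) * ∏ i, ∏ b,
        X (Function.update (fun i => Exponent.pow (d i) (a i)) i
          (Exponent.near (hd i) (a i) b)) ^ (J i).1 b) ?_ ?_
    · simpa [sub_eq_zero] using this
    · refine IsHomogeneous.sub ((isHomogeneous_X _ _).mul (isHomogeneous_X_pow _ _))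
        ((isHomogeneous_X _ _).mul (IsHomogeneous.prod _ _ _ fun i _ => ?_))
      refine Eq.subst (motive := IsHomogeneous _) (Exponent.sum_eq (J i)) ?_
      exact IsHomogeneous.prod _ _ _ fun b _ => isHomogeneous_X_pow _ _
    · intro y
      simpa [sub_eq_zero] using segreVeronese_mul_pow_sum hd y a J
  simp only [Pi.smul_apply, smul_eq_mul, segreVeronese, pureTensor, veronese, div_pow,
    Finset.prod_div_distrib]
  simp only [Finset.prod_pow_eq_pow_sum, Exponent.sum_eq]
  rw [← mul_div_assoc, ← hJ, mul_div_cancel_right₀ _ (pow_ne_zero _ ha)]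

end SegreVeronese

/-! ### Closed linear images and the Hadamard product -/

section Varieties

variable {K : Type*} [Field K] {ℓ n : ℕ} {r d : Fin ℓ → ℕ}

theorem subset_zariskiClosure (Z : Set (Pn K n)) : Z ⊆ zariskiClosure Z :=
  fun P hP _ _ _ h => h P hP

/-- The image in `ℙⁿ` of a Segre-Veronese variety under the linear map with matrix `B`. -/
def linearSegreVeronese (B : Matrix (Fin (n + 1)) (∀ i, Exponent (r i) (d i)) K) :
    Set (Pn K n) :=
  {R | ∃ (y : ∀ i, Fin (r i + 1) → K) (h : B.mulVec (segreVeronese d y) ≠ 0),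
    R = Projectivization.mk K (B.mulVec (segreVeronese d y)) h}

theorem zariskiClosure_linearSegreVeronese (hd : ∀ i, 0 < d i)
    {B : Matrix (Fin (n + 1)) (∀ i, Exponent (r i) (d i)) K} (hB : Function.Injective B.mulVec) :
    zariskiClosure (linearSegreVeronese B) = linearSegreVeronese B := by
  refine Set.Subset.antisymm (fun P hP => ?_) (subset_zariskiClosure _)
  obtain ⟨L, hL⟩ := exists_matrix_mul_eq_one hB
  have hrep : ∀ Q ∈ linearSegreVeronese B, ∃ (c : K) (y : _),
      Q.rep = c • B.mulVec (segreVeronese d y) := by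
    rintro Q ⟨y, h, rfl⟩
    obtain ⟨a, ha⟩ := Projectivization.exists_smul_eq_mk_rep K _ h
    exact ⟨a, y, ha.symm⟩
  -- The linear equations `B L x = x` hold on the image, hence on its closure, so `P` lies in the
  -- range of `B`.
  have hBL : B.mulVec (L.mulVec P.rep) = P.rep := by
    funext j
    have := hP 1 (∑ k, C ((B * L) j k) * X k - X j) ?_ ?_
    · rw [Matrix.mulVec_mulVec]
      simpa [sub_eq_zero, Matrix.mulVec, dotProduct] using this
    · refine IsHomogeneous.sub (IsHomogeneous.sum _ _ _ fun k _ => ?_) (isHomogeneous_X _ _)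
      simpa using (isHomogeneous_C _ _).mul (isHomogeneous_X K k)
    · intro Q hQ
      obtain ⟨c, y, hc⟩ := hrep Q hQ
      have hQ' : (B * L).mulVec Q.rep = Q.rep := by
        rw [hc, Matrix.mulVec_smul, Matrix.mulVec_mulVec, Matrix.mul_assoc, hL, Matrix.mul_one]
      simpa [sub_eq_zero, Matrix.mulVec, dotProduct] using congrFun hQ' j
  have hw : L.mulVec P.rep ≠ 0 := by
    intro h
    rw [h, Matrix.mulVec_zero] at hBL
    exact P.rep_nonzero hBL.symm
  have heval (F : MvPolynomial (∀ i, Exponent (r i) (d i)) K) (x : Fin (n + 1) → K) :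
      eval x (aeval (fun J => ∑ k, C (L J k) * X k) F) = eval (L.mulVec x) F := by
    rw [aeval_def, ← coe_eval₂Hom, ← RingHom.comp_apply]
    congr 1
    refine MvPolynomial.ringHom_ext (fun c => by simp) fun J => ?_
    simp [Matrix.mulVec, dotProduct]
  -- Substituting `L` turns an equation of the Segre-Veronese variety into a form of the same degree
  -- vanishing on the image, hence at `P`.
  obtain ⟨c, y, hcy⟩ := exists_eq_smul_segreVeronese hd hw fun e F hF h0 => by
    rw [← heval]
    refine hP e _ ?_ fun Q hQ => ?_
    · have := hF.aeval (fun J => ∑ k, C (L J k) * (X k : MvPolynomial (Fin (n + 1)) K)) (n := 1)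
        fun J => IsHomogeneous.sum _ _ _ fun k _ => by
          simpa using (isHomogeneous_C _ _).mul (isHomogeneous_X K k)
      simpa using this
    · obtain ⟨c, y, hc⟩ := hrep Q hQ
      rw [heval, hc, Matrix.mulVec_smul, Matrix.mulVec_mulVec, hL, Matrix.one_mulVec, eval_eq]
      have h0' := h0 y
      rw [eval_eq] at h0'
      rw [← mul_zero (c ^ e), ← h0', Finset.mul_sum]
      refine Finset.sum_congr rfl fun m hm => ?_
      have hdeg : ∑ J ∈ m.support, m J = e := by
        change m.degree = e
        rw [Finsupp.degree_eq_weight_one]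
        exact hF (mem_support_iff.mp hm)
      simp only [Pi.smul_apply, smul_eq_mul, mul_pow, Finset.prod_mul_distrib]
      rw [Finset.prod_pow_eq_pow_sum, hdeg]
      ring
  have hP' : P.rep = c • B.mulVec (segreVeronese d y) := by
    rw [← hBL, hcy, Matrix.mulVec_smul]
  have hne : B.mulVec (segreVeronese d y) ≠ 0 := by
    intro h
    rw [h, smul_zero] at hP'
    exact P.rep_nonzero hP'
  refine ⟨y, hne, ?_⟩
  rw [← P.mk_rep, Projectivization.mk_eq_mk_iff']
  exact ⟨c, hP'.symm⟩

theorem faceSplitting_injective_of_one {μ κ : Type*} [Fintype κ] {A : Matrix μ κ K}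
    (hA : Function.Injective A.mulVec) :
    Function.Injective (faceSplitting (fun _ : Fin 1 => A)).mulVec := by
  have h (w : (Fin 1 → κ) → K) : (faceSplitting (fun _ : Fin 1 => A)).mulVec w =
      A.mulVec fun m => w fun _ => m := by
    have hw : w = pureTensor (fun (_ : Fin 1) m => w fun _ => m) := by
      funext J
      simp only [pureTensor, Fin.prod_univ_one]
      congr 1
      funext i
      rw [Subsingleton.elim i 0]
    conv_lhs => rw [hw, faceSplitting_mulVec]
    simp
  intro w w' hww'
  have := hA ((h w).symm.trans (hww'.trans (h w')))
  funext J
  have hJ : J = fun _ => J 0 := by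
    funext i
    rw [Subsingleton.elim i 0]
  rw [hJ]
  exact congrFun this (J 0)

/-- Taking the closure adds no points: this is the one-factor case of
`zariskiClosure_linearSegreVeronese`. -/
theorem mem_paramVariety {r d : ℕ} (hd : 0 < d) {f : Fin (n + 1) → MvPolynomial (Fin (r + 1)) K}
    (hf : ∀ j, (f j).IsHomogeneous d) (hA : Function.Injective (coeffMatrix d f).mulVec)
    (R : Pn K n) :
    R ∈ paramVariety f ↔ ∃ (y : Fin (r + 1) → K) (h : (coeffMatrix d f).mulVec (veronese d y) ≠ 0),
      R = Projectivization.mk K ((coeffMatrix d f).mulVec (veronese d y)) h := by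
  have key (y : Fin 1 → Fin (r + 1) → K) :
      (faceSplitting (fun _ : Fin 1 => coeffMatrix d f)).mulVec
        (segreVeronese (fun _ => d) y) = (coeffMatrix d f).mulVec (veronese d (y 0)) := by
    rw [segreVeronese, faceSplitting_mulVec]
    simp
  have heq : linearSegreVeronese (r := fun _ => r) (d := fun _ => d)
      (faceSplitting (fun _ : Fin 1 => coeffMatrix d f)) =
      {R | ∃ (y : Fin (r + 1) → K) (h : (coeffMatrix d f).mulVec (veronese d y) ≠ 0),
        R = Projectivization.mk K ((coeffMatrix d f).mulVec (veronese d y)) h} := by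
    ext R
    constructor
    · rintro ⟨y, h, rfl⟩
      exact ⟨y 0, key y ▸ h, by congr 1; exact key y⟩
    · rintro ⟨y, h, rfl⟩
      exact ⟨fun _ => y, (key fun _ => y).symm ▸ h, by congr 1; exact (key fun _ => y).symm⟩
  have hcl := zariskiClosure_linearSegreVeronese (fun _ => hd)
    (faceSplitting_injective_of_one hA : Function.Injective (Matrix.mulVec
      (faceSplitting (fun _ : Fin 1 => coeffMatrix d f) :
        Matrix _ (∀ i : Fin 1, Exponent ((fun _ => r) i) ((fun _ => d) i)) K)))
  rw [heq] at hcl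
  have : paramVariety f = {R | ∃ (y : Fin (r + 1) → K)
      (h : (coeffMatrix d f).mulVec (veronese d y) ≠ 0),
        R = Projectivization.mk K ((coeffMatrix d f).mulVec (veronese d y)) h} := by
    rw [← hcl]
    simp only [paramVariety, coeffMatrix_mulVec hf]
  rw [this]
  rfl

/-- The matrix of the map from the Segre-Veronese variety to the Hadamard product. -/
noncomputable def hadamardMatrix (d : Fin ℓ → ℕ)
    (f : ∀ i, Fin (n + 1) → MvPolynomial (Fin (r i + 1)) K) :
    Matrix (Fin (n + 1)) (∀ i, Exponent (r i) (d i)) K :=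
  faceSplitting fun i => coeffMatrix (d i) (f i)

theorem hadamardMatrix_mulVec (f : ∀ i, Fin (n + 1) → MvPolynomial (Fin (r i + 1)) K)
    (y : ∀ i, Fin (r i + 1) → K) :
    (hadamardMatrix d f).mulVec (segreVeronese d y) =
      fun j => ∏ i, (coeffMatrix (d i) (f i)).mulVec (veronese (d i) (y i)) j :=
  faceSplitting_mulVec _ _

/-- The two sets agree before closure, since the scalars relating representatives to parameterized
vectors factor out of the products. -/
theorem hadamardProduct_eq (hd : ∀ i, 0 < d i)
    {f : ∀ i, Fin (n + 1) → MvPolynomial (Fin (r i + 1)) K}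
    (hf : ∀ i j, (f i j).IsHomogeneous (d i))
    (hB : Function.Injective (hadamardMatrix d f).mulVec) :
    hadamardProduct (fun i => paramVariety (f i)) = linearSegreVeronese (hadamardMatrix d f) := by
  rw [← zariskiClosure_linearSegreVeronese hd hB, hadamardProduct]
  congr 1
  have hA := mulVec_injective_of_faceSplitting hB
  ext R
  constructor
  · rintro ⟨P, hP, h, rfl⟩
    simp only [fun i => mem_paramVariety (hd i) (hf i) (hA i) (P i)] at hP
    choose y hy hPy using hP
    choose a ha using fun i => Projectivization.exists_smul_eq_mk_rep K _ (hy i)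
    have hrep : (fun j => ∏ i, (P i).rep j) =
        (∏ i, (a i : K)) • (hadamardMatrix d f).mulVec (segreVeronese d y) := by
      rw [hadamardMatrix_mulVec]
      funext j
      rw [Pi.smul_apply, smul_eq_mul, ← Finset.prod_mul_distrib]
      refine Finset.prod_congr rfl fun i _ => ?_
      rw [hPy i, ← ha i]
      rfl
    refine ⟨y, fun h0 => h (by rw [hrep, h0, smul_zero]), ?_⟩
    rw [Projectivization.mk_eq_mk_iff']
    exact ⟨_, hrep.symm⟩
  · rintro ⟨y, h, rfl⟩
    have hy (i : Fin ℓ) : (coeffMatrix (d i) (f i)).mulVec (veronese (d i) (y i)) ≠ 0 := by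
      intro h0
      refine h ?_
      rw [hadamardMatrix_mulVec]
      funext j
      exact Finset.prod_eq_zero (Finset.mem_univ i) (congrFun h0 j)
    choose a ha using fun i => Projectivization.exists_smul_eq_mk_rep K _ (hy i)
    have hrep : (fun j => ∏ i, (Projectivization.mk K _ (hy i)).rep j) =
        (∏ i, (a i : K)) • (hadamardMatrix d f).mulVec (segreVeronese d y) := by
      rw [hadamardMatrix_mulVec]
      funext j
      rw [Pi.smul_apply, smul_eq_mul, ← Finset.prod_mul_distrib]
      refine Finset.prod_congr rfl fun i _ => ?_
      rw [← ha i]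
      rfl
    have hne : (∏ i, (a i : K)) ≠ 0 := Finset.prod_ne_zero_iff.mpr fun i _ => (a i).ne_zero
    refine ⟨fun i => Projectivization.mk K _ (hy i), fun i => ?_, ?_, ?_⟩
    · exact (mem_paramVariety (hd i) (hf i) (hA i) _).mpr ⟨y i, hy i, rfl⟩
    · rw [hrep]
      exact smul_ne_zero hne h
    · symm
      rw [Projectivization.mk_eq_mk_iff']
      exact ⟨_, hrep.symm⟩

theorem projectivelyEquivalent_linearSegreVeronese
    {B M : Matrix (Fin (n + 1)) (∀ i, Exponent (r i) (d i)) K} (hB : Function.Injective B.mulVec)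
    (hM : Function.Injective M.mulVec) :
    ProjectivelyEquivalent (linearSegreVeronese B) (linearSegreVeronese M) := by
  let eB := LinearEquiv.ofInjective (Matrix.toLin' B) hB
  let eM := LinearEquiv.ofInjective (Matrix.toLin' M) hM
  obtain ⟨g, hg⟩ := Submodule.exists_linearEquiv_restrict_eq (eB.symm.trans eM)
  have hgB (w : (∀ i, Exponent (r i) (d i)) → K) : g (B.mulVec w) = M.mulVec w := by
    have h := hg (eB w)
    rw [LinearEquiv.trans_apply, LinearEquiv.symm_apply_apply] at h
    exact h.symm
  refine ⟨g, ?_⟩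
  ext R
  constructor
  · rintro ⟨_, ⟨y, h, rfl⟩, rfl⟩
    refine ⟨y, ?_, ?_⟩
    · rw [← hgB]
      exact (map_ne_zero_iff g g.injective).mpr h
    · rw [Projectivization.map_mk]
      congr 1
      exact hgB _
  · rintro ⟨y, h, rfl⟩
    have h' : B.mulVec (segreVeronese d y) ≠ 0 := by
      rw [← hgB] at h
      exact (map_ne_zero_iff g g.injective).mp h
    refine ⟨_, ⟨y, h', rfl⟩, ?_⟩
    rw [Projectivization.map_mk]
    congr 1
    exact hgB _

end Varieties

/-! ### Product varieties and genericity -/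

section ProductVariety

variable {K : Type*} [Field K] {ℓ n : ℕ} {r d : Fin ℓ → ℕ}

theorem segre_mk {h : Fin ℓ → ℕ} (q : ∀ i, Fin (h i + 1) → K) (hq : ∀ i, q i ≠ 0) :
    segre (fun i => Projectivization.mk K (q i) (hq i)) =
      Projectivization.mk K (pureTensor q) (pureTensor_ne_zero hq) := by
  choose a ha using fun i => Projectivization.exists_smul_eq_mk_rep K _ (hq i)
  rw [segre, Projectivization.mk_eq_mk_iff']
  refine ⟨∏ i, (a i : K), ?_⟩
  rw [← pureTensor_smul]
  funext J
  refine Finset.prod_congr rfl fun i _ => ?_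
  dsimp only
  rw [← ha i]
  rfl

/-- Every product variety of linearly embedded Veronese varieties is a linearly embedded
Segre-Veronese variety. -/
theorem IsProductVariety.exists_eq_linearSegreVeronese [Infinite K] (hd : ∀ i, 0 < d i)
    {f : ∀ i, Fin (n + 1) → MvPolynomial (Fin (r i + 1)) K}
    (hf : ∀ i j, (f i j).IsHomogeneous (d i))
    (hA : ∀ i, Function.Injective (coeffMatrix (d i) (f i)).mulVec) {Z : Set (Pn K n)}
    (hZ : IsProductVariety (fun i => paramVariety (f i)) Z) :
    ∃ M : Matrix (Fin (n + 1)) (∀ i, Exponent (r i) (d i)) K, Function.Injective M.mulVec ∧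
      Z = linearSegreVeronese M := by
  obtain ⟨h, φ, hφ, ι, hι, hX, rfl⟩ := hZ
  let P (i : Fin ℓ) := LinearMap.toMatrix' (φ i)
  have hPφ (i : Fin ℓ) (q : Fin (h i + 1) → K) : (P i).mulVec q = φ i q :=
    LinearMap.toMatrix'_mulVec _ _
  choose L hL using fun i => exists_matrix_mul_eq_one (B := P i)
    fun v w hvw => hφ i (by rwa [hPφ, hPφ] at hvw)
  let C (i : Fin ℓ) := L i * coeffMatrix (d i) (f i)
  -- `P i * L i` fixes the range of `φ i`, which contains every parameterized vector; equality on
  -- Veronese vectors then gives equality of matrices.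
  have hPC (i : Fin ℓ) : P i * C i = coeffMatrix (d i) (f i) := by
    refine sub_eq_zero.mp (matrix_eq_zero_of_mulVec_veronese fun y => ?_)
    rw [Matrix.sub_mulVec, sub_eq_zero, ← Matrix.mulVec_mulVec, ← Matrix.mulVec_mulVec]
    by_cases hy : (coeffMatrix (d i) (f i)).mulVec (veronese (d i) y) = 0
    · rw [hy, Matrix.mulVec_zero, Matrix.mulVec_zero]
    · obtain ⟨Q, hQ⟩ := hX i ((mem_paramVariety (hd i) (hf i) (hA i) _).mpr ⟨y, hy, rfl⟩)
      induction Q using Projectivization.ind with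
      | h q hq =>
        rw [Projectivization.map_mk, Projectivization.mk_eq_mk_iff'] at hQ
        obtain ⟨c, hc⟩ := hQ
        have hmem : (coeffMatrix (d i) (f i)).mulVec (veronese (d i) y) =
            (P i).mulVec (c⁻¹ • q) := by
          have hc0 : c ≠ 0 := by
            rintro rfl
            rw [zero_smul] at hc
            exact hq (hφ i (by rw [← hc, map_zero]))
          rw [hPφ, map_smul, ← hc, smul_smul, inv_mul_cancel₀ hc0, one_smul]
        rw [hmem, Matrix.mulVec_mulVec _ (L i), hL, Matrix.one_mulVec]
  have hφC (i : Fin ℓ) (v : Exponent (r i) (d i) → K) :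
      φ i ((C i).mulVec v) = (coeffMatrix (d i) (f i)).mulVec v := by
    rw [← hPφ, Matrix.mulVec_mulVec, hPC]
  have hC (i : Fin ℓ) : Function.Injective (C i).mulVec := fun v w hvw =>
    hA i (by rw [← hφC, ← hφC, hvw])
  choose C' hC' using fun i => exists_matrix_mul_eq_one (hC i)
  have hT : Function.Injective (kroneckerFamily C).mulVec := by
    refine Function.LeftInverse.injective (g := (kroneckerFamily C').mulVec) fun w => ?_
    rw [Matrix.mulVec_mulVec, kroneckerFamily_mul]
    simp only [hC', kroneckerFamily_one, Matrix.one_mulVec]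
  have hM (w : (∀ i, Exponent (r i) (d i)) → K) :
      (LinearMap.toMatrix' ι * kroneckerFamily C).mulVec w = ι ((kroneckerFamily C).mulVec w) := by
    rw [← Matrix.mulVec_mulVec, LinearMap.toMatrix'_mulVec]
  refine ⟨LinearMap.toMatrix' ι * kroneckerFamily C,
    fun v w hvw => hT (hι (by rwa [hM, hM] at hvw)), ?_⟩
  have hMS (y : ∀ i, Fin (r i + 1) → K) :
      (LinearMap.toMatrix' ι * kroneckerFamily C).mulVec (segreVeronese d y) =
        ι (pureTensor fun i => (C i).mulVec (veronese (d i) (y i))) := by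
    rw [hM, segreVeronese, kroneckerFamily_mulVec]
  have hmap (y : ∀ i, Fin (r i + 1) → K) (hy : ∀ i, (C i).mulVec (veronese (d i) (y i)) ≠ 0)
      (hne : (LinearMap.toMatrix' ι * kroneckerFamily C).mulVec (segreVeronese d y) ≠ 0) :
      Projectivization.map ι hι (segre fun i => Projectivization.mk K _ (hy i)) =
        Projectivization.mk K _ hne := by
    rw [segre_mk, Projectivization.map_mk]
    congr 1
    exact (hMS y).symm
  ext R
  constructor
  · rintro ⟨Q, hQ, rfl⟩
    have hQ' (i : Fin ℓ) := (mem_paramVariety (hd i) (hf i) (hA i) _).mp (hQ i)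
    choose y hy hQy using hQ'
    have hCy (i : Fin ℓ) : (C i).mulVec (veronese (d i) (y i)) ≠ 0 := by
      intro h0
      refine hy i ?_
      rw [← hφC, h0, map_zero]
    have hQeq : Q = fun i => Projectivization.mk K _ (hCy i) := by
      funext i
      refine Projectivization.map_injective (φ i) (hφ i) ?_
      rw [hQy i, Projectivization.map_mk]
      congr 1
      exact (hφC i _).symm
    have hne : (LinearMap.toMatrix' ι * kroneckerFamily C).mulVec (segreVeronese d y) ≠ 0 := by
      rw [hMS]
      exact (map_ne_zero_iff ι hι).mpr (pureTensor_ne_zero hCy)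
    refine ⟨y, hne, ?_⟩
    rw [hQeq]
    exact hmap y hCy hne
  · rintro ⟨y, hne, rfl⟩
    have hCy (i : Fin ℓ) : (C i).mulVec (veronese (d i) (y i)) ≠ 0 := by
      intro h0
      refine hne ?_
      rw [hMS, ← map_zero ι]
      congr 1
      funext J
      exact Finset.prod_eq_zero (Finset.mem_univ i) (congrFun h0 (J i))
    refine ⟨fun i => Projectivization.mk K _ (hCy i), fun i => ?_, hmap y hCy hne⟩
    refine (mem_paramVariety (hd i) (hf i) (hA i) _).mpr ⟨y i, ?_, ?_⟩
    · rw [← hφC]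
      exact (map_ne_zero_iff (φ i) (hφ i)).mpr (hCy i)
    · rw [Projectivization.map_mk]
      congr 1
      exact hφC i _

/-- The ranges of the coefficient matrices serve as the subspaces `Lᵢ`, and the Hadamard matrix
itself places the Segre target in `ℙⁿ`. -/
theorem exists_isProductVariety (hd : ∀ i, 0 < d i)
    {f : ∀ i, Fin (n + 1) → MvPolynomial (Fin (r i + 1)) K}
    (hf : ∀ i j, (f i j).IsHomogeneous (d i))
    (hB : Function.Injective (hadamardMatrix d f).mulVec) :
    ∃ Z, IsProductVariety (fun i => paramVariety (f i)) Z := by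
  have hA := mulVec_injective_of_faceSplitting hB
  let e (i : Fin ℓ) : Fin (Fintype.card (Exponent (r i) (d i)) - 1 + 1) ≃ Exponent (r i) (d i) :=
    (finCongr (Nat.sub_add_cancel Fintype.card_pos)).trans (Fintype.equivFin _).symm
  let φ (i : Fin ℓ) := (Matrix.toLin' (coeffMatrix (d i) (f i))).comp
    (LinearEquiv.funCongrLeft K K (e i).symm).toLinearMap
  have hφ (i : Fin ℓ) : Function.Injective (φ i) :=
    (hA i).comp (LinearEquiv.funCongrLeft K K (e i).symm).injective
  let ι := (Matrix.toLin' (hadamardMatrix d f)).comp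
    (LinearEquiv.funCongrLeft K K (Equiv.piCongrRight e).symm).toLinearMap
  have hι : Function.Injective ι :=
    hB.comp (LinearEquiv.funCongrLeft K K (Equiv.piCongrRight e).symm).injective
  refine ⟨_, fun i => Fintype.card (Exponent (r i) (d i)) - 1, φ, hφ, ι, hι, fun i R hR => ?_, rfl⟩
  obtain ⟨y, hy, rfl⟩ := (mem_paramVariety (hd i) (hf i) (hA i) R).mp hR
  have hv : φ i ((LinearEquiv.funCongrLeft K K (e i).symm).symm (veronese (d i) y)) =
      (coeffMatrix (d i) (f i)).mulVec (veronese (d i) y) := by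
    simp only [φ, LinearMap.comp_apply, LinearEquiv.coe_coe, LinearEquiv.apply_symm_apply,
      Matrix.toLin'_apply]
  refine ⟨Projectivization.mk K
    ((LinearEquiv.funCongrLeft K K (e i).symm).symm (veronese (d i) y)) ?_, ?_⟩
  · intro h0
    refine hy ?_
    rw [← hv, h0, map_zero]
  · rw [Projectivization.map_mk]
    congr 1

/-- `D` is the minor of the Hadamard matrix on the rows `σ J`, with the coefficients as
indeterminates. -/
theorem exists_polynomial_hadamardMatrix_injective
    (hcard : Fintype.card (∀ i, Exponent (r i) (d i)) ≤ n + 1) :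
    ∃ D : MvPolynomial ((i : Fin ℓ) × Fin (n + 1) × Exponent (r i) (d i)) K, D ≠ 0 ∧
      ∀ f : (∀ i, Fin (n + 1) → MvPolynomial (Fin (r i + 1)) K),
        eval (fun s => coeff s.2.2.1 (f s.1 s.2.1)) D ≠ 0 →
        Function.Injective (hadamardMatrix d f).mulVec := by
  obtain ⟨σ⟩ : Nonempty ((∀ i, Exponent (r i) (d i)) ↪ Fin (n + 1)) :=
    Function.Embedding.nonempty_of_card_le (by simpa using hcard)
  let G : Matrix (∀ i, Exponent (r i) (d i)) (∀ i, Exponent (r i) (d i))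
      (MvPolynomial ((i : Fin ℓ) × Fin (n + 1) × Exponent (r i) (d i)) K) :=
    fun J J' => ∏ i, X ⟨i, σ J, J' i⟩
  have hG (x : ((i : Fin ℓ) × Fin (n + 1) × Exponent (r i) (d i)) → K) :
      eval x G.det = Matrix.det (fun J J' => ∏ i, x ⟨i, σ J, J' i⟩) := by
    rw [RingHom.map_det]
    congr 1
    ext J J'
    change eval x (∏ i, X ⟨i, σ J, J' i⟩) = _
    simp
  refine ⟨G.det, fun h0 => ?_, fun f hf => ?_⟩
  -- Specialize row `σ J` of the i-th coefficient matrix to the basis vector at `J i`; the minor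
  -- becomes the determinant of the identity.
  · have h := hG fun s => if (Function.invFun σ s.2.1) s.1 = s.2.2 then 1 else 0
    have hone : (fun J J' : (∀ i, Exponent (r i) (d i)) =>
        ∏ i, if (Function.invFun σ (σ J)) i = J' i then (1 : K) else 0) =
        (1 : Matrix (∀ i, Exponent (r i) (d i)) (∀ i, Exponent (r i) (d i)) K) := by
      ext J J'
      rw [Function.leftInverse_invFun σ.injective J, Matrix.one_apply, Finset.prod_ite_zero]
      simp [_root_.funext_iff]
    dsimp only at h
    rw [hone, h0, map_zero, Matrix.det_one] at h
    exact zero_ne_one h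
  · rw [hG] at hf
    have hinj := Matrix.mulVec_injective_of_isUnit
      ((Matrix.isUnit_iff_isUnit_det _).mpr (isUnit_iff_ne_zero.mpr hf))
    intro v w hvw
    refine hinj ?_
    funext J
    exact congrFun hvw (σ J)

end ProductVariety

end HadamardVar

theorem mainTheorem5 {K : Type*} [Field K] [IsAlgClosed K] [CharZero K]
    {ℓ : ℕ} (hℓ : 0 < ℓ) (n : ℕ) (r d : Fin ℓ → ℕ)
    (hr : ∀ i, 0 < r i) (hd : ∀ i, 0 < d i)
    (hn : (∏ i, (r i + d i).choose (d i)) - 1 ≤ n) :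
    HadamardVar.ForGenericForms K n r d (fun f =>
      (∃ Z, HadamardVar.IsProductVariety (fun i => HadamardVar.paramVariety (f i)) Z) ∧
      ∀ Z, HadamardVar.IsProductVariety (fun i => HadamardVar.paramVariety (f i)) Z →
        HadamardVar.ProjectivelyEquivalent
          (HadamardVar.hadamardProduct (fun i => HadamardVar.paramVariety (f i))) Z) := by
  have hcard : Fintype.card (∀ i, HadamardVar.Exponent (r i) (d i)) ≤ n + 1 := by
    simp only [Fintype.card_pi, HadamardVar.card_exponent]
    omega
  obtain ⟨D, hD0, hD⟩ := HadamardVar.exists_polynomial_hadamardMatrix_injective (K := K) hcard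
  refine ⟨D, hD0, fun f hf hDf => ?_⟩
  have hB := hD f hDf
  refine ⟨HadamardVar.exists_isProductVariety hd hf hB, fun Z hZ => ?_⟩
  obtain ⟨M, hM, rfl⟩ := hZ.exists_eq_linearSegreVeronese hd hf
    (HadamardVar.mulVec_injective_of_faceSplitting hB)
  rw [HadamardVar.hadamardProduct_eq hd hf hB]
  exact HadamardVar.projectivelyEquivalent_linearSegreVeronese hB hM
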